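/- Let $n_1,n_2\ge 1$ be integers, $n=n_1+n_2+1$, and let $\mathbb S^n\subset\mathbb R^{n+1}=\mathbb R^{n_1+1}\times\mathbb R^{n_2+1}$ be the unit sphere. For $0<a<1$ and $b=\sqrt{1-a^2}$, the generalized Clifford torus is $$\mathbb T(a,b)=\{(x,y)\in\mathbb R^{n_1+1}\times\mathbb R^{n_2+1} : |x|=a,\ |y|=b\}\subset\mathbb S^n .$$ For $k\in\mathbb R$, a map $\varphi$ from a Riemannian manifold $(M,g)$ to $\mathbb S^n$ is called biharmonic of index $k$ if $$\Delta\,\delta T\varphi-\operatorname{tr}_g R_{\delta T\varphi,\,T\varphi}T\varphi+k\,\delta T\varphi=0,$$ where $\delta T\varphi=-\operatorname{tr}_g\nabla T\varphi$, $\Delta=-\operatorname{tr}_g\nabla^2$ is the rough Laplacian of $\varphi^*T\mathbb S^n$ and $R_{X,Y}Z=\nabla_X\nabla_YZ-\nabla_Y\nabla_XZ-\nabla_{[X,Y]}Z$ is the curvature tensor of $\mathbb S^n$; it is harmonic if $\delta T\varphi=0$. A submanifold $M\subset\mathbb S^n$ with its induced metric is properly biharmonic of index $k$ if its inclusion is biharmonic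 of index $k$ and is not harmonic. Fix $n_1,n_2$ and $k\in\mathbb R$. Then: 1. If $k>n_1+n_2-2\sqrt{n_1n_2}$, no generalized Clifford torus $\mathbb T(a,b)$ is properly biharmonic of index $k$. 2. If $k=n_1+n_2-2\sqrt{n_1n_2}$ and $k\neq0$, exactly one generalized Clifford torus is properly biharmonic of index $k$. 3. If $k<n_1+n_2-2\sqrt{n_1n_2}$ and $k\neq0$, exactly two generalized Clifford tori are properly biharmonic of index $k$; if moreover $n_1=n_2$, these two are $\mathbb T(a,b)$ and $\mathbb T(b,a)$ for some $a,b>0$ with $a^2+b^2=1$, $a\ne b$. -/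

import Mathlib

open Set
open scoped ContDiff RealInnerProductSpace

noncomputable section

namespace BiharmonicIndex

/-- The model space `ℝᵐ` in which local coordinates take their values. -/
abbrev Coord (m : ℕ) : Type := EuclideanSpace ℝ (Fin m)

section Sphere

variable {V : Type*} [NormedAddCommGroup V] [InnerProductSpace ℝ V]

/-- The unit sphere of `V`, with the metric induced by `V`. -/
def unitSphere (V : Type*) [NormedAddCommGroup V] [InnerProductSpace ℝ V] : Set V :=
  Metric.sphere (0 : V) 1

/-- For `p` in the unit sphere, the orthogonal projection of `V` onto the tangent space
`T_p S = {v | ⟪p, v⟫ = 0}`. -/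
def tangentProj (p v : V) : V := v - ⟪p, v⟫ • p

/-- The Levi-Civita connection `∇_X Y` of the unit sphere (the tangential part of the derivative),
for vector fields `X`, `Y` of `V` that are tangent to the sphere along the sphere. -/
def sphereNabla (X Y : V → V) : V → V := fun q => tangentProj q (fderiv ℝ Y q (X q))

/-- The curvature tensor `R_{x,y} z = ∇_X ∇_Y Z - ∇_Y ∇_X Z - ∇_{[X,Y]} Z` of the unit sphere at
`p`, for tangent vectors `x, y, z` at `p`. The tangent vectors are extended to the vector fields
`q ↦ tangentProj q x`, etc., which are tangent to the sphere; the value at `p` does not depend on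
the choice of the extensions. -/
def sphereCurvature (p x y z : V) : V :=
  let X : V → V := fun q => tangentProj q x
  let Y : V → V := fun q => tangentProj q y
  let Z : V → V := fun q => tangentProj q z
  sphereNabla X (sphereNabla Y Z) p - sphereNabla Y (sphereNabla X Z) p
    - sphereNabla (VectorField.lieBracket ℝ X Y) Z p

end Sphere

section Coordinates

variable {m : ℕ} {W : Type*} [NormedAddCommGroup W] [NormedSpace ℝ W]
variable {V : Type*} [NormedAddCommGroup V] [InnerProductSpace ℝ V]

/-- The partial derivative `∂ᵢ X` at `u`. -/
def partialDeriv (X : Coord m → W) (i : Fin m) (u : Coord m) : W :=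
  fderiv ℝ X u (EuclideanSpace.single i 1)

/-- The Christoffel symbol `Γˡᵢⱼ = ½ ∑ᵣ gˡʳ (∂ᵢ gⱼᵣ + ∂ⱼ gᵢᵣ - ∂ᵣ gᵢⱼ)` of a Riemannian metric `g`
written in coordinates. -/
def christoffel (g : Coord m → Matrix (Fin m) (Fin m) ℝ) (l i j : Fin m) (u : Coord m) : ℝ :=
  (1 / 2 : ℝ) * ∑ r, (g u)⁻¹ l r *
    (partialDeriv (fun w => g w j r) i u + partialDeriv (fun w => g w i r) j u
      - partialDeriv (fun w => g w i j) r u)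

/-- The covariant derivative `∇_{∂ᵢ} X` in the bundle `φ^* TS` of a section `X` along a map `φ` into
the unit sphere of `V`. -/
def pullbackNabla (φ X : Coord m → V) (i : Fin m) (u : Coord m) : V :=
  tangentProj (φ u) (partialDeriv X i u)

/-- The divergence `δTφ = - ∑ gⁱʲ (∇_{∂ᵢ} (∂ⱼφ) - ∑ₗ Γˡᵢⱼ ∂ₗφ)` of the differential `Tφ`, a section
of `T^*M ⊗ φ^* TS`, for a map `φ` from `(M, g)` to the unit sphere, in coordinates of `M`. -/
def divDifferential (g : Coord m → Matrix (Fin m) (Fin m) ℝ) (φ : Coord m → V) (u : Coord m) : V :=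
  -∑ i, ∑ j, (g u)⁻¹ i j • (pullbackNabla φ (partialDeriv φ j) i u
    - ∑ l, christoffel g l i j u • partialDeriv φ l u)

/-- The (nonnegative) rough Laplacian
`ΔX = - ∑ gⁱʲ (∇_{∂ᵢ} ∇_{∂ⱼ} X - ∑ₗ Γˡᵢⱼ ∇_{∂ₗ} X)` on sections `X` of `φ^* TS`. -/
def roughLaplacian (g : Coord m → Matrix (Fin m) (Fin m) ℝ) (φ X : Coord m → V)
    (u : Coord m) : V :=
  -∑ i, ∑ j, (g u)⁻¹ i j • (pullbackNabla φ (pullbackNabla φ X j) i u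
    - ∑ l, christoffel g l i j u • pullbackNabla φ X l u)

/-- The endomorphism `X ↦ tr_g R_{X, Tφ} Tφ` of `φ^* TS`. -/
def curvatureTrace (g : Coord m → Matrix (Fin m) (Fin m) ℝ) (φ X : Coord m → V)
    (u : Coord m) : V :=
  ∑ i, ∑ j, (g u)⁻¹ i j •
    sphereCurvature (φ u) (X u) (partialDeriv φ i u) (partialDeriv φ j u)

/-- In coordinates with domain `U` and metric `g`, the map `φ` into the unit sphere is harmonic:
`δTφ = 0`. -/
def HarmonicOn (g : Coord m → Matrix (Fin m) (Fin m) ℝ) (φ : Coord m → V)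
    (U : Set (Coord m)) : Prop :=
  ∀ u ∈ U, divDifferential g φ u = 0

/-- In coordinates with domain `U` and metric `g`, the map `φ` into the unit sphere is biharmonic of
index `k`: `Δ δTφ - tr_g R_{δTφ, Tφ} Tφ + k δTφ = 0`. -/
def BiharmonicOn (k : ℝ) (g : Coord m → Matrix (Fin m) (Fin m) ℝ) (φ : Coord m → V)
    (U : Set (Coord m)) : Prop :=
  ∀ u ∈ U, roughLaplacian g φ (divDifferential g φ) u
    - curvatureTrace g φ (divDifferential g φ) u + k • divDifferential g φ u = 0

/-- The metric induced by `V` on a parametrized submanifold, `gᵢⱼ = ⟪∂ᵢφ, ∂ⱼφ⟫`. -/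
def inducedMetric (φ : Coord m → V) (u : Coord m) : Matrix (Fin m) (Fin m) ℝ :=
  Matrix.of fun i j => ⟪partialDeriv φ i u, partialDeriv φ j u⟫

/-- `φ`, restricted to the open set `U ⊆ ℝᵐ`, is a smooth local parametrization of `M ⊆ V`: a smooth
immersion that is a homeomorphism of `U` onto a relatively open subset of `M`. -/
structure IsLocalParametrization (M : Set V) (U : Set (Coord m)) (φ : Coord m → V) : Prop where
  isOpen : IsOpen U
  contDiffOn : ContDiffOn ℝ ∞ φ U
  injective_fderiv : ∀ u ∈ U, Function.Injective (fderiv ℝ φ u)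
  isEmbedding : Topology.IsEmbedding (U.domRestrict φ)
  image_eq : ∃ O : Set V, IsOpen O ∧ φ '' U = O ∩ M

/-- `M` is an `m`-dimensional embedded smooth submanifold of `V` contained in the unit sphere. -/
def IsSphereSubmanifold (m : ℕ) (M : Set V) : Prop :=
  M ⊆ unitSphere V ∧ ∀ p ∈ M, ∃ (U : Set (Coord m)) (φ : Coord m → V),
    IsLocalParametrization M U φ ∧ p ∈ φ '' U

/-- The inclusion of the `m`-dimensional submanifold `M`, with its induced metric, in the unit
sphere is harmonic. -/
def IsHarmonicSubmanifold (m : ℕ) (M : Set V) : Prop :=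
  IsSphereSubmanifold m M ∧ ∀ (U : Set (Coord m)) (φ : Coord m → V),
    IsLocalParametrization M U φ → HarmonicOn (inducedMetric φ) φ U

/-- The inclusion of the `m`-dimensional submanifold `M`, with its induced metric, in the unit
sphere is biharmonic of index `k`. -/
def IsBiharmonicSubmanifold (m : ℕ) (k : ℝ) (M : Set V) : Prop :=
  IsSphereSubmanifold m M ∧ ∀ (U : Set (Coord m)) (φ : Coord m → V),
    IsLocalParametrization M U φ → BiharmonicOn k (inducedMetric φ) φ U

/-- `M` is properly biharmonic of index `k`: biharmonic of index `k` and not harmonic. -/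
def IsProperlyBiharmonic (m : ℕ) (k : ℝ) (M : Set V) : Prop :=
  IsBiharmonicSubmanifold m k M ∧ ¬ IsHarmonicSubmanifold m M

end Coordinates

/-- The Euclidean space `ℝ^{n₁+1} × ℝ^{n₂+1} = ℝ^{n+1}` with `n = n₁ + n₂ + 1`. -/
abbrev Ambient (n₁ n₂ : ℕ) : Type :=
  WithLp 2 (EuclideanSpace ℝ (Fin (n₁ + 1)) × EuclideanSpace ℝ (Fin (n₂ + 1)))

/-- `T(a, b) = S^{n₁}(a) × S^{n₂}(b)`, the set of `(x, y)` with `|x| = a`, `|y| = b`. -/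
def torus (n₁ n₂ : ℕ) (a b : ℝ) : Set (Ambient n₁ n₂) := {p | ‖p.fst‖ = a ∧ ‖p.snd‖ = b}

/-- The generalized Clifford tori of the unit sphere: the sets `T(a, b)` with `0 < a < 1` and
`b = √(1 - a²)`. -/
def IsCliffordTorus (n₁ n₂ : ℕ) (T : Set (Ambient n₁ n₂)) : Prop :=
  ∃ a ∈ Ioo (0 : ℝ) 1, T = torus n₁ n₂ a (√(1 - a ^ 2))

/-- The set of generalized Clifford tori, of type `(n₁, n₂)`, that are properly biharmonic of
index `k`. -/
def properTori (n₁ n₂ : ℕ) (k : ℝ) : Set (Set (Ambient n₁ n₂)) :=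
  {T | IsCliffordTorus n₁ n₂ T ∧ IsProperlyBiharmonic (n₁ + n₂) k T}

end BiharmonicIndex

end

/-! At a point `(x, y)` of a torus `T(a, b)`, the normal space in the ambient Euclidean space is
spanned by `(x, 0)` and `(0, y)`, so every field in the biharmonic equation has the form `blockScale
α β φ` with constant `α`, `β`. The computation becomes algebra in these two coefficients.

The Euclidean mean curvature is `(-n₁ x / a², -n₂ y / b²)` (`meanCurvature_torus`). It determines
both `δTφ` and the rough Laplacian of a field `blockScale α β φ`, because a constant linear map
commutes with differentiation (`sum_tangentProj_apply`). Constant curvature makes the curvature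
trace multiplication by `n₁ + n₂` on fields normal to the torus and tangent to the sphere. Hence the
bitension field is a scalar multiple of `δTφ` (`biharmonic_torus`).

With `t = a² / b²`, the scalar vanishes iff `n₂ t² - (n₁ + n₂ - k) t + n₁ = 0`, and the torus is
harmonic iff `n₂ t = n₁`. A harmonic root forces `k = 0`, so for `k ≠ 0` it remains to count the
positive roots. Their product is `n₁ / n₂`; when `n₁ = n₂` they are mutually inverse, and inverting
`t` exchanges `a` and `b`. -/

namespace BiharmonicIndex

/-! ### Curvature of the unit sphere. -/

section Curvature

variable {V : Type*} [NormedAddCommGroup V] [InnerProductSpace ℝ V]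

theorem tangentProj_of_inner_eq_zero {p v : V} (h : ⟪p, v⟫ = 0) : tangentProj p v = v := by
  simp [tangentProj, h]

theorem HasFDerivAt.tangentProj {W : V → V} {W' : V →L[ℝ] V} {p : V} (hW : HasFDerivAt W W' p) :
    HasFDerivAt (fun q => BiharmonicIndex.tangentProj q (W q))
      (W' - (⟪p, W p⟫ • ContinuousLinearMap.id ℝ V
        + ((innerSL ℝ p).comp W' + innerSL ℝ (W p)).smulRight p)) p := by
  have h1 : HasFDerivAt (fun q => ⟪q, W q⟫) ((innerSL ℝ p).comp W' + innerSL ℝ (W p)) p := by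
    refine ((hasFDerivAt_id p).inner ℝ hW).congr_fderiv ?_
    ext v
    simp [real_inner_comm]
  exact hW.sub (h1.smul (hasFDerivAt_id p))

/-- Along the sphere, the tangential derivative of the tangential part of a vector field. -/
theorem tangentProj_fderiv_tangentProj {W : V → V} {p x : V} (hW : DifferentiableAt ℝ W p)
    (hp : ⟪p, p⟫ = 1) (hx : ⟪p, x⟫ = 0) :
    tangentProj p (fderiv ℝ (fun q => tangentProj q (W q)) p x)
      = tangentProj p (fderiv ℝ W p x) - ⟪p, W p⟫ • x := by
  rw [(HasFDerivAt.tangentProj hW.hasFDerivAt).fderiv]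
  simp only [tangentProj, sub_apply, add_apply,
    smul_apply, ContinuousLinearMap.id_apply,
    ContinuousLinearMap.smulRight_apply, inner_sub_right, inner_add_right, inner_smul_right, hp, hx]
  module

theorem fderiv_tangentProj_const (z p x : V) :
    fderiv ℝ (fun q => tangentProj q z) p x = -(⟪x, z⟫ • p + ⟪p, z⟫ • x) := by
  rw [(HasFDerivAt.tangentProj (hasFDerivAt_const z p)).fderiv]
  change 0 - (⟪p, z⟫ • x + (innerSL ℝ p 0 + ⟪z, x⟫) • p) = _
  rw [map_zero, real_inner_comm x z]
  module

/-- On the sphere, `∇_Y Z` at `q` is `-⟪q, z⟫ Y(q)`. Its coefficient vanishes at `p`, so only the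
derivative `⟪x, z⟫` of the coefficient survives. -/
theorem sphereNabla_sphereNabla_tangentProj {p x y z : V} (hp : ⟪p, p⟫ = 1) (hx : ⟪p, x⟫ = 0)
    (hy : ⟪p, y⟫ = 0) (hz : ⟪p, z⟫ = 0) :
    sphereNabla (fun q => tangentProj q x)
      (sphereNabla (fun q => tangentProj q y) fun q => tangentProj q z) p = -(⟪x, z⟫ • y) := by
  obtain ⟨Y', hY, hYp⟩ : ∃ Y' : V →L[ℝ] V, HasFDerivAt (fun q => tangentProj q y) Y' p ∧
      Y' x = -(⟪x, y⟫ • p) := by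
    have h : HasFDerivAt (fun q => tangentProj q y) _ p :=
      HasFDerivAt.tangentProj (hasFDerivAt_const y p)
    refine ⟨_, h, ?_⟩
    rw [← h.fderiv, fderiv_tangentProj_const, hy, zero_smul, add_zero]
  have hW : HasFDerivAt
      (fun q => -(⟪tangentProj q y, z⟫ • q + ⟪q, z⟫ • tangentProj q y)) _ p :=
    (((hY.inner ℝ (hasFDerivAt_const z p)).smul (hasFDerivAt_id p)).add
      (((hasFDerivAt_id p).inner ℝ (hasFDerivAt_const z p)).smul hY)).neg
  have hW' : fderiv ℝ (fun q => -(⟪tangentProj q y, z⟫ • q + ⟪q, z⟫ • tangentProj q y)) p x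
      = -(⟪y, z⟫ • x + ⟪x, z⟫ • y) := by
    rw [hW.fderiv]
    change -(⟪tangentProj p y, z⟫ • x + (⟪tangentProj p y, (0 : V)⟫ + ⟪Y' x, z⟫) • p
      + (⟪p, z⟫ • Y' x + (⟪p, (0 : V)⟫ + ⟪x, z⟫) • tangentProj p y)) = _
    rw [hYp, hz, tangentProj_of_inner_eq_zero hy, inner_neg_left, inner_smul_left, hz]
    simp
  rw [sphereNabla, tangentProj_of_inner_eq_zero hx]
  unfold sphereNabla
  simp only [fderiv_tangentProj_const]
  rw [tangentProj_fderiv_tangentProj hW.differentiableAt hp hx, hW',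
    tangentProj_of_inner_eq_zero hy]
  simp only [tangentProj, inner_neg_right, inner_add_right, inner_smul_right, hp, hx, hy, hz]
  module

/-- The unit sphere has constant curvature one. -/
theorem sphereCurvature_eq {p x y z : V} (hp : ⟪p, p⟫ = 1) (hx : ⟪p, x⟫ = 0)
    (hy : ⟪p, y⟫ = 0) (hz : ⟪p, z⟫ = 0) :
    sphereCurvature p x y z = ⟪y, z⟫ • x - ⟪x, z⟫ • y := by
  -- At `p` each extension has derivative `-⟪x, y⟫ p` along the other vector. This is symmetric in
  -- `x` and `y`, so the bracket vanishes.
  have hb : VectorField.lieBracket ℝ (fun q => tangentProj q x) (fun q => tangentProj q y) p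
      = 0 := by
    rw [VectorField.lieBracket, tangentProj_of_inner_eq_zero hx, tangentProj_of_inner_eq_zero hy,
      fderiv_tangentProj_const, fderiv_tangentProj_const, hx, hy, real_inner_comm]
    simp
  have h0 : sphereNabla (VectorField.lieBracket ℝ (fun q => tangentProj q x)
      (fun q => tangentProj q y)) (fun q => tangentProj q z) p = 0 := by
    rw [sphereNabla, hb]
    simp [tangentProj]
  simp only [sphereCurvature]
  rw [sphereNabla_sphereNabla_tangentProj hp hx hy hz,
    sphereNabla_sphereNabla_tangentProj hp hy hx hz, h0]
  abel

end Curvature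

/-! ### Normal space and tangential traces of the torus. -/

section BlockScale

variable {n₁ n₂ : ℕ}

/-- The linear map `(x, y) ↦ (α x, β y)`. -/
noncomputable def blockScale (α β : ℝ) : Ambient n₁ n₂ →L[ℝ] Ambient n₁ n₂ :=
  let e : Ambient n₁ n₂ ≃L[ℝ] EuclideanSpace ℝ (Fin (n₁ + 1)) × EuclideanSpace ℝ (Fin (n₂ + 1)) :=
    WithLp.prodContinuousLinearEquiv 2 ℝ _ _
  e.symm.toContinuousLinearMap ∘L
    ((α • ContinuousLinearMap.fst ℝ _ _).prod (β • ContinuousLinearMap.snd ℝ _ _)) ∘L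
    e.toContinuousLinearMap

@[simp]
theorem blockScale_fst (α β : ℝ) (p : Ambient n₁ n₂) : (blockScale α β p).fst = α • p.fst := rfl

@[simp]
theorem blockScale_snd (α β : ℝ) (p : Ambient n₁ n₂) : (blockScale α β p).snd = β • p.snd := rfl

theorem ambient_ext {p q : Ambient n₁ n₂} (h1 : p.fst = q.fst) (h2 : p.snd = q.snd) : p = q :=
  WithLp.ofLp_injective 2 (Prod.ext h1 h2)

theorem blockScale_one (p : Ambient n₁ n₂) : blockScale 1 1 p = p :=
  ambient_ext (by simp) (by simp)

theorem blockScale_blockScale (α β α' β' : ℝ) (p : Ambient n₁ n₂) :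
    blockScale α β (blockScale α' β' p) = blockScale (α * α') (β * β') p :=
  ambient_ext (by simp [mul_smul]) (by simp [mul_smul])

theorem smul_blockScale (c α β : ℝ) (p : Ambient n₁ n₂) :
    c • blockScale α β p = blockScale (c * α) (c * β) p :=
  ambient_ext (by simp [mul_smul]) (by simp [mul_smul])

theorem blockScale_add (α β α' β' : ℝ) (p : Ambient n₁ n₂) :
    blockScale α β p + blockScale α' β' p = blockScale (α + α') (β + β') p :=
  ambient_ext (by simp [add_smul]) (by simp [add_smul])

theorem blockScale_sub (α β α' β' : ℝ) (p : Ambient n₁ n₂) :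
    blockScale α β p - blockScale α' β' p = blockScale (α - α') (β - β') p :=
  ambient_ext (by simp [sub_smul]) (by simp [sub_smul])

theorem inner_blockScale (α β : ℝ) (p q : Ambient n₁ n₂) :
    ⟪blockScale α β p, q⟫ = α * ⟪p.fst, q.fst⟫ + β * ⟪p.snd, q.snd⟫ := by
  simp [WithLp.prod_inner_apply, inner_smul_left]

theorem inner_blockScale_right (α β : ℝ) (p q : Ambient n₁ n₂) :
    ⟪p, blockScale α β q⟫ = ⟪blockScale α β p, q⟫ := by
  rw [real_inner_comm, inner_blockScale, inner_blockScale, real_inner_comm p.fst,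
    real_inner_comm p.snd]

theorem inner_blockScale_self {a b : ℝ} (α β : ℝ) {p : Ambient n₁ n₂} (hp : p ∈ torus n₁ n₂ a b) :
    ⟪blockScale α β p, p⟫ = α * a ^ 2 + β * b ^ 2 := by
  rw [inner_blockScale, real_inner_self_eq_norm_sq, real_inner_self_eq_norm_sq, hp.1, hp.2]

theorem blockScale_eq_zero_iff {a b α β : ℝ} (ha : 0 < a) (hb : 0 < b) {p : Ambient n₁ n₂}
    (hp : p ∈ torus n₁ n₂ a b) : blockScale α β p = 0 ↔ α = 0 ∧ β = 0 := by
  constructor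
  · intro h
    have h1 : α • p.fst = 0 := congrArg WithLp.fst h
    have h2 : β • p.snd = 0 := congrArg WithLp.snd h
    have h3 : p.fst ≠ 0 := by rw [← norm_pos_iff, hp.1]; exact ha
    have h4 : p.snd ≠ 0 := by rw [← norm_pos_iff, hp.2]; exact hb
    exact ⟨(smul_eq_zero.1 h1).resolve_right h3, (smul_eq_zero.1 h2).resolve_right h4⟩
  · rintro ⟨rfl, rfl⟩
    exact ambient_ext (by simp) (by simp)

/-- A vector orthogonal to the tangent space of the torus at `p = (x, y)` is a combination of
`(x, 0)` and `(0, y)`. -/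
theorem eq_blockScale_of_orthogonal {a b : ℝ} (ha : 0 < a) (hb : 0 < b) {p : Ambient n₁ n₂}
    (hp : p ∈ torus n₁ n₂ a b) {t : Fin (n₁ + n₂) → Ambient n₁ n₂} (ht : LinearIndependent ℝ t)
    (hn : ∀ α β i, ⟪blockScale α β p, t i⟫ = 0) {w : Ambient n₁ n₂} (hw : ∀ i, ⟪t i, w⟫ = 0) :
    w = blockScale (⟪blockScale 1 0 p, w⟫ / a ^ 2) (⟪blockScale 0 1 p, w⟫ / b ^ 2) p := by
  set T : Submodule ℝ (Ambient n₁ n₂) := Submodule.span ℝ (range t) with hT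
  have hmem : ∀ v : Ambient n₁ n₂, (∀ i, ⟪t i, v⟫ = 0) → v ∈ Tᗮ := by
    intro v hv
    rw [hT, Submodule.mem_orthogonal]
    intro u hu
    induction hu using Submodule.span_induction with
    | mem x hx => obtain ⟨i, rfl⟩ := hx; exact hv i
    | zero => simp
    | add x y _ _ h1 h2 => rw [inner_add_left, h1, h2, add_zero]
    | smul c x _ h => rw [inner_smul_left, h, mul_zero]
  have hd : Module.finrank ℝ (Ambient n₁ n₂) = n₁ + 1 + (n₂ + 1) := by
    rw [(WithLp.linearEquiv 2 ℝ _).finrank_eq]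
    simp
  have hT1 : Module.finrank ℝ T = n₁ + n₂ := by
    rw [hT, finrank_span_eq_card ht, Fintype.card_fin]
  -- The ambient dimension exceeds that of the tangent space by two, so two independent normal
  -- vectors exhaust the normal space.
  have hT2 : Module.finrank ℝ Tᗮ = 2 := by
    have := T.finrank_add_finrank_orthogonal
    omega
  have hcomb : ∀ c d : ℝ, c • blockScale 1 0 p + d • blockScale 0 1 p = blockScale c d p := by
    intro c d
    simp [smul_blockScale, blockScale_add]
  have hli : LinearIndependent ℝ ![blockScale 1 0 p, blockScale 0 1 p] := by
    rw [LinearIndependent.pair_iff]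
    intro c d h
    rwa [hcomb, blockScale_eq_zero_iff ha hb hp] at h
  have hS : Submodule.span ℝ (range ![blockScale 1 0 p, blockScale 0 1 p]) = Tᗮ := by
    refine Submodule.eq_of_le_of_finrank_eq ?_ ?_
    · rw [Submodule.span_le]
      rintro _ ⟨i, rfl⟩
      refine hmem _ fun j => ?_
      fin_cases i
      · exact (real_inner_comm _ _).trans (hn 1 0 j)
      · exact (real_inner_comm _ _).trans (hn 0 1 j)
    · rw [finrank_span_eq_card hli, hT2, Fintype.card_fin]
  have hwT := hmem w hw
  rw [← hS, Matrix.range_cons_cons_empty, Submodule.mem_span_pair] at hwT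
  obtain ⟨c, d, rfl⟩ := hwT
  rw [hcomb, inner_blockScale_right, inner_blockScale_right, blockScale_blockScale,
    blockScale_blockScale, inner_blockScale_self _ _ hp, inner_blockScale_self _ _ hp]
  congr 1
  congr 1 <;> field_simp <;> ring

/-- The Gram matrix of a frame. -/
def gramMatrix {m : ℕ} {V : Type*} [NormedAddCommGroup V] [InnerProductSpace ℝ V] (t : Fin m → V) :
    Matrix (Fin m) (Fin m) ℝ :=
  Matrix.of fun i j => ⟪t i, t j⟫

section Gram

variable {m : ℕ} {V : Type*} [NormedAddCommGroup V] [InnerProductSpace ℝ V] {t : Fin m → V}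

theorem sum_gramMatrix_inv_mul (ht : LinearIndependent ℝ t) (i j : Fin m) :
    ∑ r, (gramMatrix t)⁻¹ i r * ⟪t r, t j⟫ = if i = j then 1 else 0 := by
  have h : IsUnit (gramMatrix t).det :=
    (Matrix.posDef_gram_of_linearIndependent (𝕜 := ℝ) ht).det_pos.ne'.isUnit
  have h1 := congrFun (congrFun (Matrix.nonsing_inv_mul (gramMatrix t) h) i) j
  rwa [Matrix.mul_apply, Matrix.one_apply] at h1

theorem gramMatrix_inv_symm (i j : Fin m) : (gramMatrix t)⁻¹ i j = (gramMatrix t)⁻¹ j i := by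
  have h : (gramMatrix t).transpose = gramMatrix t := by
    ext i j
    exact real_inner_comm _ _
  have h1 := Matrix.transpose_nonsing_inv (gramMatrix t)
  rw [h] at h1
  exact congrFun (congrFun h1 j) i

/-- Subtracting from `w` its orthogonal projection onto the span of a frame leaves a vector
orthogonal to the frame. -/
theorem inner_sub_sum_gramMatrix_inv (ht : LinearIndependent ℝ t) (w : V) (l : Fin m) :
    ⟪t l, w - ∑ i, ∑ j, ((gramMatrix t)⁻¹ i j * ⟪t j, w⟫) • t i⟫ = 0 := by
  simp only [inner_sub_right, inner_sum, inner_smul_right]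
  rw [Finset.sum_comm]
  have h : ∀ j, ∑ i, (gramMatrix t)⁻¹ i j * ⟪t j, w⟫ * ⟪t l, t i⟫
      = if j = l then ⟪t j, w⟫ else 0 := by
    intro j
    have h1 := sum_gramMatrix_inv_mul ht j l
    calc _ = ⟪t j, w⟫ * ∑ r, (gramMatrix t)⁻¹ j r * ⟪t r, t l⟫ := by
          rw [Finset.mul_sum]
          refine Finset.sum_congr rfl fun i _ => ?_
          rw [gramMatrix_inv_symm, real_inner_comm (t i)]
          ring
      _ = _ := by rw [h1, mul_ite, mul_one, mul_zero]
  simp [h]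

end Gram

/-- The trace of `blockScale α β` over the tangent space of the torus. -/
theorem sum_gramMatrix_inv_inner_blockScale {a b : ℝ} (ha : 0 < a) (hb : 0 < b)
    {p : Ambient n₁ n₂} (hp : p ∈ torus n₁ n₂ a b) {t : Fin (n₁ + n₂) → Ambient n₁ n₂}
    (ht : LinearIndependent ℝ t) (hn : ∀ α β i, ⟪blockScale α β p, t i⟫ = 0) (α β : ℝ) :
    ∑ i, ∑ j, (gramMatrix t)⁻¹ i j * ⟪blockScale α β (t i), t j⟫ = α * n₁ + β * n₂ := by
  let e := (EuclideanSpace.basisFun (Fin (n₁ + 1)) ℝ).prod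
    (EuclideanSpace.basisFun (Fin (n₂ + 1)) ℝ)
  -- The inverse Gram matrix gives the orthogonal projection onto the tangent space. The tangential
  -- trace is thus the ambient trace composed with this projection: `α (n₁ + 1) + β (n₂ + 1)` less
  -- `α` and `β` from the two normal directions.
  have hproj : ∀ w : Ambient n₁ n₂, ∑ i, ∑ j, ((gramMatrix t)⁻¹ i j * ⟪t j, w⟫) • t i
      = w - blockScale (⟪blockScale 1 0 p, w⟫ / a ^ 2) (⟪blockScale 0 1 p, w⟫ / b ^ 2) p := by
    intro w
    have h := eq_blockScale_of_orthogonal ha hb hp ht hn (inner_sub_sum_gramMatrix_inv ht w)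
    have h0 : ∀ α β, ⟪blockScale α β p, ∑ i, ∑ j, ((gramMatrix t)⁻¹ i j * ⟪t j, w⟫) • t i⟫ = 0 := by
      intro α β
      simp [inner_sum, inner_smul_right, hn]
    rw [inner_sub_right, inner_sub_right, h0, h0, sub_zero, sub_zero] at h
    rw [← h, sub_sub_cancel]
  have key : ∑ i, ∑ j, (gramMatrix t)⁻¹ i j * ⟪blockScale α β (t i), t j⟫
      = ∑ s, ⟪blockScale α β (e s),
          ∑ i, ∑ j, ((gramMatrix t)⁻¹ i j * ⟪t j, e s⟫) • t i⟫ := by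
    simp only [inner_sum, inner_smul_right]
    conv_rhs => rw [Finset.sum_comm]
    refine Finset.sum_congr rfl fun i _ => ?_
    conv_rhs => rw [Finset.sum_comm]
    refine Finset.sum_congr rfl fun j _ => ?_
    rw [← e.sum_inner_mul_inner, Finset.mul_sum]
    refine Finset.sum_congr rfl fun s _ => ?_
    rw [← inner_blockScale_right α β (e s), real_inner_comm (e s), real_inner_comm (t j)]
    ring
  have hnorm : ∑ s, ⟪blockScale α β (e s), e s⟫ = α * (n₁ + 1) + β * (n₂ + 1) := by
    rw [Fintype.sum_sum_type]
    simp [e, inner_smul_left, mul_comm]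
  have hpars : ∀ γ δ γ' δ' : ℝ, ∑ s, ⟪blockScale γ δ p, e s⟫ * ⟪blockScale γ' δ' p, e s⟫
      = γ * γ' * a ^ 2 + δ * δ' * b ^ 2 := by
    intro γ δ γ' δ'
    rw [← inner_blockScale_self _ _ hp, mul_comm γ, mul_comm δ, ← blockScale_blockScale,
      ← inner_blockScale_right, ← e.sum_inner_mul_inner (blockScale γ δ p)]
    exact Finset.sum_congr rfl fun s _ => by rw [real_inner_comm (e s) (blockScale γ' δ' p)]
  have hsum : ∀ s, ⟪blockScale α β (e s),
      blockScale (⟪blockScale 1 0 p, e s⟫ / a ^ 2) (⟪blockScale 0 1 p, e s⟫ / b ^ 2) p⟫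
      = α / a ^ 2 * (⟪blockScale 1 0 p, e s⟫ * ⟪blockScale 1 0 p, e s⟫)
        + β / b ^ 2 * (⟪blockScale 0 1 p, e s⟫ * ⟪blockScale 0 1 p, e s⟫) := by
    intro s
    rw [← inner_blockScale_right, blockScale_blockScale, real_inner_comm]
    simp only [inner_blockScale]
    ring
  simp only [key, hproj, inner_sub_right, Finset.sum_sub_distrib, hsum, Finset.sum_add_distrib,
    ← Finset.mul_sum, hpars, hnorm]
  field_simp
  ring

end BlockScale

/-! ### Local parametrizations of spheres and tori. -/

section Charts

variable {m : ℕ} {V : Type*} [NormedAddCommGroup V] [InnerProductSpace ℝ V]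

/-- A smooth map with a smooth left inverse that is also a right inverse on a relatively open part
of `M` is a local parametrization of `M`. -/
theorem isLocalParametrization_of_leftInverse {M O : Set V} {φ : Coord m → V} {ψ : V → Coord m}
    (hO : IsOpen O) (hφ : ContDiff ℝ ∞ φ) (hψ : ContDiffOn ℝ ∞ ψ O) (hφO : ∀ u, φ u ∈ O ∩ M)
    (hleft : ∀ u, ψ (φ u) = u) (hright : ∀ p ∈ O ∩ M, φ (ψ p) = p) :
    IsLocalParametrization M univ φ where
  isOpen := isOpen_univ
  contDiffOn := hφ.contDiffOn
  injective_fderiv u _ := by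
    have h1 : DifferentiableAt ℝ ψ (φ u) :=
      (hψ.contDiffAt (hO.mem_nhds (hφO u).1)).differentiableAt (by simp)
    have h2 : DifferentiableAt ℝ φ u := hφ.contDiffAt.differentiableAt (by simp)
    have h3 : (fderiv ℝ ψ (φ u)).comp (fderiv ℝ φ u) = ContinuousLinearMap.id ℝ (Coord m) := by
      rw [← fderiv_comp u h1 h2, show ψ ∘ φ = id from funext hleft, fderiv_id]
    exact Function.LeftInverse.injective fun v => DFunLike.congr_fun h3 v
  isEmbedding := by
    have h : Topology.IsInducing φ := by
      refine ⟨le_antisymm hφ.continuous.le_induced ?_⟩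
      rw [le_iff_nhds]
      intro u s hs
      rw [nhds_induced]
      have h1 : ContinuousAt ψ (φ u) :=
        (hψ.contDiffAt (hO.mem_nhds (hφO u).1)).continuousAt
      refine ⟨ψ ⁻¹' s, h1 (by rwa [hleft]), ?_⟩
      intro w hw
      simpa [hleft] using hw
    refine Topology.IsEmbedding.comp ⟨h, Function.LeftInverse.injective hleft⟩ .subtypeVal
  image_eq := by
    refine ⟨O, hO, ?_⟩
    ext p
    constructor
    · rintro ⟨u, -, rfl⟩
      exact hφO u
    · exact fun hp => ⟨ψ p, trivial, hright p hp⟩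

/-- Spheres in Euclidean space have smooth parametrizations defined on a whole vector space,
around each of their points. -/
theorem exists_sphere_parametrization {n : ℕ} {r : ℝ} (hr : 0 < r)
    (x₀ : EuclideanSpace ℝ (Fin (n + 1))) (hx₀ : ‖x₀‖ = r) :
    ∃ (σ : Coord n → EuclideanSpace ℝ (Fin (n + 1))) (τ : EuclideanSpace ℝ (Fin (n + 1)) → Coord n)
      (O : Set (EuclideanSpace ℝ (Fin (n + 1)))), IsOpen O ∧ ContDiff ℝ ∞ σ ∧ ContDiffOn ℝ ∞ τ O ∧
      (∀ w, σ w ∈ O ∧ ‖σ w‖ = r) ∧ (∀ w, τ (σ w) = w) ∧ (∀ x ∈ O, ‖x‖ = r → σ (τ x) = x) ∧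
      x₀ ∈ O := by
  -- The pole of the stereographic projection is antipodal to `x₀ / r`, so that `x₀` lies in the
  -- chart.
  set v : EuclideanSpace ℝ (Fin (n + 1)) := -(r⁻¹ • x₀) with hv_def
  have hv : ‖v‖ = 1 := by
    rw [hv_def, norm_neg, norm_smul, hx₀, norm_inv, Real.norm_of_nonneg hr.le,
      inv_mul_cancel₀ hr.ne']
  have hv0 : v ≠ 0 := by
    rintro h
    simp [h] at hv
  have : Fact (Module.finrank ℝ (EuclideanSpace ℝ (Fin (n + 1))) = n + 1) :=
    ⟨finrank_euclideanSpace_fin⟩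
  let e := (OrthonormalBasis.fromOrthogonalSpanSingleton (𝕜 := ℝ) n hv0).repr
  have hne (x : EuclideanSpace ℝ (Fin (n + 1))) (hx : ‖x‖ = 1) : innerSL ℝ v x ≠ 1 ↔ x ≠ v := by
    rw [innerSL_apply_apply, ne_eq, inner_eq_one_iff_of_norm_eq_one hv hx, eq_comm]
  refine ⟨fun w => r • (stereoInvFun hv (e.symm w) : EuclideanSpace ℝ (Fin (n + 1))),
    fun x => e (stereoToFun v (r⁻¹ • x)), {x | innerSL ℝ v (r⁻¹ • x) ≠ 1}, ?_, ?_, ?_, ?_, ?_, ?_,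
    ?_⟩
  · exact isOpen_ne_fun (by fun_prop) continuous_const
  · exact ((contDiff_stereoInvFunAux (v := v)).comp
      ((ℝ ∙ v)ᗮ.subtypeL.contDiff.comp e.symm.contDiff)).const_smul r
  · refine e.contDiff.comp_contDiffOn ?_
    exact contDiffOn_stereoToFun.comp (contDiff_const_smul r⁻¹).contDiffOn fun x hx => hx
  · intro w
    have h1 : ‖(stereoInvFun hv (e.symm w) : EuclideanSpace ℝ (Fin (n + 1)))‖ = 1 :=
      norm_eq_of_mem_sphere _
    refine ⟨?_, ?_⟩
    · rw [mem_ofPred_eq, smul_smul, inv_mul_cancel₀ hr.ne', one_smul, hne _ h1]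
      exact fun h => stereoInvFun_ne_north_pole hv (e.symm w) (Subtype.ext h)
    · rw [norm_smul, h1, Real.norm_of_nonneg hr.le, mul_one]
  · intro w
    simp only [smul_smul, inv_mul_cancel₀ hr.ne', one_smul, stereo_right_inv,
      LinearIsometryEquiv.apply_symm_apply]
  · intro x hx hxr
    have h1 : ‖r⁻¹ • x‖ = 1 := by
      rw [norm_smul, hxr, norm_inv, Real.norm_of_nonneg hr.le, inv_mul_cancel₀ hr.ne']
    have h2 := stereo_left_inv hv (x := ⟨r⁻¹ • x, by simpa using h1⟩) ((hne _ h1).1 hx)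
    simp only [LinearIsometryEquiv.symm_apply_apply]
    rw [h2, smul_smul, mul_inv_cancel₀ hr.ne', one_smul]
  · have h1 : r⁻¹ • x₀ = -v := by simp [hv_def]
    rw [mem_ofPred_eq, h1, innerSL_apply_apply, inner_neg_right, real_inner_self_eq_norm_sq, hv]
    norm_num

theorem torus_nonempty (n₁ n₂ : ℕ) {a b : ℝ} (ha : 0 ≤ a) (hb : 0 ≤ b) :
    (torus n₁ n₂ a b).Nonempty :=
  ⟨WithLp.toLp 2 (EuclideanSpace.single 0 a, EuclideanSpace.single 0 b), by
    simp [ha], by simp [hb]⟩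

theorem torus_subset_unitSphere {n₁ n₂ : ℕ} {a b : ℝ} (hab : a ^ 2 + b ^ 2 = 1) :
    torus n₁ n₂ a b ⊆ unitSphere (Ambient n₁ n₂) := by
  rintro p ⟨h1, h2⟩
  have h := WithLp.prod_norm_sq_eq_of_L2 p
  rw [h1, h2, hab] at h
  rw [unitSphere, mem_sphere_zero_iff_norm]
  nlinarith [norm_nonneg p]

/-- Products of sphere charts cover the torus. Since these charts are defined on whole vector
spaces, any linear isomorphism of the right dimensions combines their domains. The existence of
charts also lets a global condition be tested at a point. -/
theorem isSphereSubmanifold_torus {n₁ n₂ : ℕ} {a b : ℝ} (ha : 0 < a) (hb : 0 < b)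
    (hab : a ^ 2 + b ^ 2 = 1) : IsSphereSubmanifold (n₁ + n₂) (torus n₁ n₂ a b) := by
  refine ⟨torus_subset_unitSphere hab, ?_⟩
  rintro p ⟨hp1, hp2⟩
  obtain ⟨σ₁, τ₁, O₁, hO₁, hσ₁, hτ₁, hm₁, hl₁, hr₁, hx₁⟩ :=
    exists_sphere_parametrization ha p.fst hp1
  obtain ⟨σ₂, τ₂, O₂, hO₂, hσ₂, hτ₂, hm₂, hl₂, hr₂, hx₂⟩ :=
    exists_sphere_parametrization hb p.snd hp2
  let e : Coord (n₁ + n₂) ≃L[ℝ] Coord n₁ × Coord n₂ :=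
    ContinuousLinearEquiv.ofFinrankEq (by simp)
  let E : Ambient n₁ n₂ ≃L[ℝ] _ := WithLp.prodContinuousLinearEquiv 2 ℝ
    (EuclideanSpace ℝ (Fin (n₁ + 1))) (EuclideanSpace ℝ (Fin (n₂ + 1)))
  let φ : Coord (n₁ + n₂) → Ambient n₁ n₂ := fun u => E.symm (σ₁ (e u).1, σ₂ (e u).2)
  let ψ : Ambient n₁ n₂ → Coord (n₁ + n₂) := fun q => e.symm (τ₁ (E q).1, τ₂ (E q).2)
  have hright : ∀ q ∈ E ⁻¹' (O₁ ×ˢ O₂) ∩ torus n₁ n₂ a b, φ (ψ q) = q := by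
    rintro q ⟨hq, hq1, hq2⟩
    simp only [φ, ψ, ContinuousLinearEquiv.apply_symm_apply]
    rw [hr₁ _ hq.1 hq1, hr₂ _ hq.2 hq2]
    exact E.symm_apply_apply q
  refine ⟨univ, φ, isLocalParametrization_of_leftInverse (O := E ⁻¹' (O₁ ×ˢ O₂)) (ψ := ψ)
    ((hO₁.prod hO₂).preimage E.continuous) ?_ ?_ ?_ ?_ hright, ψ p, trivial,
    hright p ⟨⟨hx₁, hx₂⟩, hp1, hp2⟩⟩
  · exact E.symm.contDiff.comp ((hσ₁.comp (contDiff_fst.comp e.contDiff)).prodMk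
      (hσ₂.comp (contDiff_snd.comp e.contDiff)))
  · refine e.symm.contDiff.comp_contDiffOn (ContDiffOn.prodMk ?_ ?_)
    · exact hτ₁.comp (contDiff_fst.comp E.contDiff).contDiffOn fun q hq => hq.1
    · exact hτ₂.comp (contDiff_snd.comp E.contDiff).contDiffOn fun q hq => hq.2
  · exact fun u => ⟨⟨(hm₁ _).1, (hm₂ _).1⟩, (hm₁ _).2, (hm₂ _).2⟩
  · intro u
    simp only [φ, ψ, ContinuousLinearEquiv.apply_symm_apply, hl₁, hl₂]
    exact e.symm_apply_apply u

end Charts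

/-! ### Second fundamental form of a parametrized submanifold. -/

section Immersion

variable {m : ℕ} {V : Type*} [NormedAddCommGroup V] [InnerProductSpace ℝ V]
variable {φ X Y : Coord m → V} {u : Coord m}

theorem partialDeriv_congr (h : X =ᶠ[nhds u] Y) (i : Fin m) :
    partialDeriv X i u = partialDeriv Y i u := by
  rw [partialDeriv, partialDeriv, h.fderiv_eq]

theorem partialDeriv_clm_apply {W : Type*} [NormedAddCommGroup W] [NormedSpace ℝ W]
    (A : V →L[ℝ] W) (hX : DifferentiableAt ℝ X u) (i : Fin m) :
    partialDeriv (fun w => A (X w)) i u = A (partialDeriv X i u) := by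
  have h : HasFDerivAt (fun w => A (X w)) (A ∘L fderiv ℝ X u) u :=
    A.hasFDerivAt.comp u hX.hasFDerivAt
  rw [partialDeriv, h.fderiv]
  rfl

theorem partialDeriv_inner (hX : DifferentiableAt ℝ X u) (hY : DifferentiableAt ℝ Y u)
    (i : Fin m) : partialDeriv (fun w => ⟪X w, Y w⟫) i u
      = ⟪X u, partialDeriv Y i u⟫ + ⟪partialDeriv X i u, Y u⟫ :=
  fderiv_inner_apply ℝ hX hY _

theorem contDiffAt_partialDeriv (h : ContDiffAt ℝ ∞ φ u) (i : Fin m) :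
    ContDiffAt ℝ ∞ (partialDeriv φ i) u :=
  (h.fderiv_right (by simp)).clm_apply contDiffAt_const

theorem differentiableAt_partialDeriv (h : ContDiffAt ℝ ∞ φ u) (i : Fin m) :
    DifferentiableAt ℝ (partialDeriv φ i) u :=
  (contDiffAt_partialDeriv h i).differentiableAt (by simp)

theorem partialDeriv_comm (h : ContDiffAt ℝ ∞ φ u) (i j : Fin m) :
    partialDeriv (partialDeriv φ j) i u = partialDeriv (partialDeriv φ i) j u := by
  have hd : DifferentiableAt ℝ (fderiv ℝ φ) u :=
    (h.fderiv_right (m := ∞) (by simp)).differentiableAt (by simp)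
  have hs : IsSymmSndFDerivAt ℝ φ u :=
    h.isSymmSndFDerivAt (by simpa using WithTop.coe_le_coe.2 (le_top : (2 : ℕ∞) ≤ ⊤))
  have key : ∀ i j : Fin m, partialDeriv (partialDeriv φ j) i u
      = fderiv ℝ (fderiv ℝ φ) u (EuclideanSpace.single i 1) (EuclideanSpace.single j 1) := by
    intro i j
    have h1 := hd.hasFDerivAt.clm_apply (hasFDerivAt_const (EuclideanSpace.single j (1 : ℝ)) u)
    change fderiv ℝ (fun w => fderiv ℝ φ w (EuclideanSpace.single j 1)) u _ = _
    rw [h1.fderiv]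
    simp
  rw [key, key]
  exact hs.eq _ _

theorem linearIndependent_partialDeriv (h : Function.Injective (fderiv ℝ φ u)) :
    LinearIndependent ℝ fun i => partialDeriv φ i u := by
  have h1 := (EuclideanSpace.basisFun (Fin m) ℝ).toBasis.linearIndependent.map'
    (fderiv ℝ φ u : Coord m →ₗ[ℝ] V) (LinearMap.ker_eq_bot.2 h)
  have h2 : (fun i => partialDeriv φ i u)
      = (fderiv ℝ φ u : Coord m →ₗ[ℝ] V) ∘ (EuclideanSpace.basisFun (Fin m) ℝ).toBasis := by
    funext i
    simp [partialDeriv]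
  rw [h2]
  exact h1

/-- The Koszul formula for a parametrized submanifold. -/
theorem christoffel_inducedMetric (h : ContDiffAt ℝ ∞ φ u) (l i j : Fin m) :
    christoffel (inducedMetric φ) l i j u
      = ∑ r, (gramMatrix fun i => partialDeriv φ i u)⁻¹ l r *
          ⟪partialDeriv φ r u, partialDeriv (partialDeriv φ j) i u⟫ := by
  have hd : ∀ s r q, partialDeriv (fun w => inducedMetric φ w s r) q u
      = ⟪partialDeriv φ s u, partialDeriv (partialDeriv φ r) q u⟫
        + ⟪partialDeriv (partialDeriv φ s) q u, partialDeriv φ r u⟫ := fun s r q =>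
    partialDeriv_inner (differentiableAt_partialDeriv h s) (differentiableAt_partialDeriv h r) q
  rw [christoffel, Finset.mul_sum]
  refine Finset.sum_congr rfl fun r _ => ?_
  -- By symmetry of second derivatives, four of the six terms cancel and the other two coincide.
  rw [hd, hd, hd, partialDeriv_comm h i r, partialDeriv_comm h j r, partialDeriv_comm h j i,
    real_inner_comm (partialDeriv φ r u), real_inner_comm (partialDeriv φ j u)]
  change 1 / 2 * ((gramMatrix fun i => partialDeriv φ i u)⁻¹ l r * _) = _
  ring

/-- The second fundamental form in the ambient Euclidean space. -/
noncomputable def secondForm (φ : Coord m → V) (u : Coord m) (i j : Fin m) : V :=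
  partialDeriv (partialDeriv φ j) i u
    - ∑ l, christoffel (inducedMetric φ) l i j u • partialDeriv φ l u

/-- By the Koszul formula, the Christoffel terms are exactly the tangential projection of the second
derivative. -/
theorem inner_partialDeriv_secondForm (h : ContDiffAt ℝ ∞ φ u)
    (hi : Function.Injective (fderiv ℝ φ u)) (i j r : Fin m) :
    ⟪partialDeriv φ r u, secondForm φ u i j⟫ = 0 := by
  rw [← inner_sub_sum_gramMatrix_inv (linearIndependent_partialDeriv hi)
    (partialDeriv (partialDeriv φ j) i u) r, secondForm]
  simp only [christoffel_inducedMetric h, Finset.sum_smul]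

/-- The trace of the second fundamental form. -/
noncomputable def meanCurvature (φ : Coord m → V) (u : Coord m) : V :=
  ∑ i, ∑ j, (inducedMetric φ u)⁻¹ i j • secondForm φ u i j

theorem inner_partialDeriv_meanCurvature (h : ContDiffAt ℝ ∞ φ u)
    (hi : Function.Injective (fderiv ℝ φ u)) (r : Fin m) :
    ⟪partialDeriv φ r u, meanCurvature φ u⟫ = 0 := by
  simp [meanCurvature, inner_sum, inner_smul_right, inner_partialDeriv_secondForm h hi]

/-- The orthogonal projection to the tangent space of the sphere, as a continuous linear map. -/
noncomputable def tangentProjL (p : V) : V →L[ℝ] V :=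
  ContinuousLinearMap.id ℝ V - (innerSL ℝ p).smulRight p

theorem tangentProjL_apply (p v : V) : tangentProjL p v = tangentProj p v := by
  simp [tangentProjL, tangentProj]

/-- This covers both second-order operators: `A = 1` gives `-δTφ`, and `A = blockScale α β` gives
minus the rough Laplacian of `A φ`. By `hA` the projection can be inserted in the Christoffel terms
too, after which linearity pulls it and `A` out of the sum. -/
theorem sum_tangentProj_apply (A : V →L[ℝ] V)
    (hA : ∀ i, ⟪φ u, A (partialDeriv φ i u)⟫ = 0) :
    ∑ i, ∑ j, (inducedMetric φ u)⁻¹ i j •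
        (tangentProj (φ u) (A (partialDeriv (partialDeriv φ j) i u))
          - ∑ l, christoffel (inducedMetric φ) l i j u • A (partialDeriv φ l u))
      = tangentProj (φ u) (A (meanCurvature φ u)) := by
  have h : ∀ l, A (partialDeriv φ l u) = tangentProjL (φ u) (A (partialDeriv φ l u)) := by
    intro l
    rw [tangentProjL_apply, tangentProj_of_inner_eq_zero (hA l)]
  conv_lhs =>
    enter [2, i, 2, j, 2, 2, 2, l]
    rw [h]
  simp only [← tangentProjL_apply, meanCurvature, secondForm, map_sum, map_sub, map_smul]

end Immersion

/-! ### Tension and bitension fields of the torus. -/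

section Torus

variable {n₁ n₂ : ℕ} {a b : ℝ} {U : Set (Coord (n₁ + n₂))} {φ : Coord (n₁ + n₂) → Ambient n₁ n₂}
variable {u : Coord (n₁ + n₂)}

theorem IsLocalParametrization.mem {m : ℕ} {V : Type*} [NormedAddCommGroup V]
    [InnerProductSpace ℝ V] {M : Set V} {U : Set (Coord m)} {φ : Coord m → V} {u : Coord m}
    (h : IsLocalParametrization M U φ) (hu : u ∈ U) : φ u ∈ M := by
  obtain ⟨O, -, hO⟩ := h.image_eq
  exact (hO ▸ mem_image_of_mem φ hu : φ u ∈ O ∩ M).2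

theorem IsLocalParametrization.contDiffAt {m : ℕ} {V : Type*} [NormedAddCommGroup V]
    [InnerProductSpace ℝ V] {M : Set V} {U : Set (Coord m)} {φ : Coord m → V} {u : Coord m}
    (h : IsLocalParametrization M U φ) (hu : u ∈ U) : ContDiffAt ℝ ∞ φ u :=
  h.contDiffOn.contDiffAt (h.isOpen.mem_nhds hu)

/-- The function `⟪blockScale α β φ, φ⟫` is constant on the torus; as `blockScale` is self-adjoint,
its derivative is twice this product. -/
theorem inner_blockScale_partialDeriv (h : IsLocalParametrization (torus n₁ n₂ a b) U φ)
    (hu : u ∈ U) (α β : ℝ) (i : Fin (n₁ + n₂)) :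
    ⟪blockScale α β (φ u), partialDeriv φ i u⟫ = 0 := by
  have hd : DifferentiableAt ℝ φ u := (h.contDiffAt hu).differentiableAt (by simp)
  have hc : (fun w => ⟪blockScale α β (φ w), φ w⟫) =ᶠ[nhds u] fun _ => α * a ^ 2 + β * b ^ 2 := by
    filter_upwards [h.isOpen.mem_nhds hu] with w hw
    exact inner_blockScale_self α β (h.mem hw)
  have h1 : partialDeriv (fun w => ⟪blockScale α β (φ w), φ w⟫) i u = 0 := by
    rw [partialDeriv, hc.fderiv_eq]
    simp
  have hA : DifferentiableAt ℝ (fun w => blockScale α β (φ w)) u :=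
    (blockScale α β).differentiableAt.comp u hd
  rw [partialDeriv_inner hA hd, partialDeriv_clm_apply _ hd] at h1
  have h2 : ⟪blockScale α β (partialDeriv φ i u), φ u⟫
      = ⟪blockScale α β (φ u), partialDeriv φ i u⟫ := by
    rw [← inner_blockScale_right, real_inner_comm]
  linarith

theorem inner_blockScale_partialDeriv_partialDeriv
    (h : IsLocalParametrization (torus n₁ n₂ a b) U φ) (hu : u ∈ U) (α β : ℝ)
    (i j : Fin (n₁ + n₂)) :
    ⟪blockScale α β (φ u), partialDeriv (partialDeriv φ j) i u⟫
      = -⟪blockScale α β (partialDeriv φ i u), partialDeriv φ j u⟫ := by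
  have hd : DifferentiableAt ℝ φ u := (h.contDiffAt hu).differentiableAt (by simp)
  have hc : (fun w => ⟪blockScale α β (φ w), partialDeriv φ j w⟫) =ᶠ[nhds u] fun _ => 0 := by
    filter_upwards [h.isOpen.mem_nhds hu] with w hw
    exact inner_blockScale_partialDeriv h hw α β j
  have h1 : partialDeriv (fun w => ⟪blockScale α β (φ w), partialDeriv φ j w⟫) i u = 0 := by
    rw [partialDeriv, hc.fderiv_eq]
    simp
  have hA : DifferentiableAt ℝ (fun w => blockScale α β (φ w)) u :=
    (blockScale α β).differentiableAt.comp u hd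
  rw [partialDeriv_inner hA (differentiableAt_partialDeriv (h.contDiffAt hu) j),
    partialDeriv_clm_apply _ hd] at h1
  linarith

/-- The mean curvature is normal, hence fixed by its products with `blockScale α β φ`.
Differentiating the orthogonality to `∂ⱼφ` turns these into minus the tangential trace of
`blockScale α β`. -/
theorem meanCurvature_torus (ha : 0 < a) (hb : 0 < b)
    (h : IsLocalParametrization (torus n₁ n₂ a b) U φ) (hu : u ∈ U) :
    meanCurvature φ u = blockScale (-(n₁ / a ^ 2)) (-(n₂ / b ^ 2)) (φ u) := by
  have hi := h.injective_fderiv u hu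
  have key : ∀ α β : ℝ, ⟪blockScale α β (φ u), meanCurvature φ u⟫ = -(α * n₁ + β * n₂) := by
    intro α β
    rw [← sum_gramMatrix_inv_inner_blockScale ha hb (h.mem hu)
      (linearIndependent_partialDeriv hi) (inner_blockScale_partialDeriv h hu)]
    simp only [meanCurvature, secondForm, inner_sum, inner_smul_right, inner_sub_right,
      inner_blockScale_partialDeriv h hu, inner_blockScale_partialDeriv_partialDeriv h hu,
      mul_zero, Finset.sum_const_zero, sub_zero, mul_neg, Finset.sum_neg_distrib]
    rfl
  rw [eq_blockScale_of_orthogonal ha hb (h.mem hu) (linearIndependent_partialDeriv hi)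
    (inner_blockScale_partialDeriv h hu)
    (inner_partialDeriv_meanCurvature (h.contDiffAt hu) hi), key, key]
  congr 1
  congr 1 <;> ring

theorem tangentProj_blockScale (hp : φ u ∈ torus n₁ n₂ a b) (α β : ℝ) :
    tangentProj (φ u) (blockScale α β (φ u))
      = blockScale (α - (α * a ^ 2 + β * b ^ 2)) (β - (α * a ^ 2 + β * b ^ 2)) (φ u) := by
  have h : ∀ c : ℝ, c • φ u = blockScale c c (φ u) := by
    intro c
    conv_lhs => rw [← blockScale_one (φ u), smul_blockScale, mul_one]
  rw [tangentProj, inner_blockScale_right, inner_blockScale_self α β hp, h, blockScale_sub]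

theorem tangentProj_blockScale_meanCurvature (ha : 0 < a) (hb : 0 < b)
    (h : IsLocalParametrization (torus n₁ n₂ a b) U φ) (hu : u ∈ U) (α β : ℝ) :
    -tangentProj (φ u) (blockScale α β (meanCurvature φ u))
      = blockScale (α * n₁ / a ^ 2 - (α * n₁ + β * n₂)) (β * n₂ / b ^ 2 - (α * n₁ + β * n₂))
          (φ u) := by
  rw [meanCurvature_torus ha hb h hu, blockScale_blockScale, tangentProj_blockScale (h.mem hu),
    ← neg_one_smul ℝ, smul_blockScale]
  congr 1
  congr 1 <;> field_simp <;> ring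

theorem inner_apply_blockScale_partialDeriv (h : IsLocalParametrization (torus n₁ n₂ a b) U φ)
    (hu : u ∈ U) (α β : ℝ) (i : Fin (n₁ + n₂)) :
    ⟪φ u, blockScale α β (partialDeriv φ i u)⟫ = 0 := by
  rw [inner_blockScale_right, inner_blockScale_partialDeriv h hu]

theorem divDifferential_torus (ha : 0 < a) (hb : 0 < b)
    (h : IsLocalParametrization (torus n₁ n₂ a b) U φ) (hu : u ∈ U) :
    divDifferential (inducedMetric φ) φ u
      = blockScale (n₁ / a ^ 2 - (n₁ + n₂)) (n₂ / b ^ 2 - (n₁ + n₂)) (φ u) := by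
  have h1 := sum_tangentProj_apply (φ := φ) (u := u) (blockScale 1 1)
    (inner_apply_blockScale_partialDeriv h hu 1 1)
  have h2 := tangentProj_blockScale_meanCurvature ha hb h hu 1 1
  rw [← h1] at h2
  simp only [blockScale_one, one_mul] at h2
  exact h2

theorem pullbackNabla_blockScale (h : IsLocalParametrization (torus n₁ n₂ a b) U φ) (hu : u ∈ U)
    {X : Coord (n₁ + n₂) → Ambient n₁ n₂} {α β : ℝ} (hX : ∀ w ∈ U, X w = blockScale α β (φ w))
    (j : Fin (n₁ + n₂)) :
    pullbackNabla φ X j u = blockScale α β (partialDeriv φ j u) := by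
  have hc : X =ᶠ[nhds u] fun w => blockScale α β (φ w) := by
    filter_upwards [h.isOpen.mem_nhds hu] with w hw using hX w hw
  rw [pullbackNabla, partialDeriv_congr hc,
    partialDeriv_clm_apply _ ((h.contDiffAt hu).differentiableAt (by simp)),
    tangentProj_of_inner_eq_zero (inner_apply_blockScale_partialDeriv h hu α β j)]

theorem roughLaplacian_blockScale (ha : 0 < a) (hb : 0 < b)
    (h : IsLocalParametrization (torus n₁ n₂ a b) U φ) (hu : u ∈ U)
    {X : Coord (n₁ + n₂) → Ambient n₁ n₂} {α β : ℝ} (hX : ∀ w ∈ U, X w = blockScale α β (φ w)) :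
    roughLaplacian (inducedMetric φ) φ X u
      = blockScale (α * n₁ / a ^ 2 - (α * n₁ + β * n₂)) (β * n₂ / b ^ 2 - (α * n₁ + β * n₂))
          (φ u) := by
  have hc : ∀ j, pullbackNabla φ X j =ᶠ[nhds u] fun w => blockScale α β (partialDeriv φ j w) := by
    intro j
    filter_upwards [h.isOpen.mem_nhds hu] with w hw
    exact pullbackNabla_blockScale h hw hX j
  have h1 : ∀ i j, pullbackNabla φ (pullbackNabla φ X j) i u
      = tangentProj (φ u) (blockScale α β (partialDeriv (partialDeriv φ j) i u)) := by
    intro i j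
    rw [pullbackNabla, partialDeriv_congr (hc j),
      partialDeriv_clm_apply _ (differentiableAt_partialDeriv (h.contDiffAt hu) j)]
  rw [← tangentProj_blockScale_meanCurvature ha hb h hu, ← sum_tangentProj_apply _
    (inner_apply_blockScale_partialDeriv h hu α β), roughLaplacian]
  simp only [h1, pullbackNabla_blockScale h hu hX]

/-- The condition `hαβ` makes `X` tangent to the sphere, so the constant curvature formula applies.
The term `⟪X, ∂ⱼφ⟫` drops out because `X` is normal to the torus, and the rest is the trace of the
identity. -/
theorem curvatureTrace_blockScale (ha : 0 < a) (hb : 0 < b) (hab : a ^ 2 + b ^ 2 = 1)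
    (h : IsLocalParametrization (torus n₁ n₂ a b) U φ) (hu : u ∈ U)
    {X : Coord (n₁ + n₂) → Ambient n₁ n₂} {α β : ℝ} (hX : X u = blockScale α β (φ u))
    (hαβ : α * a ^ 2 + β * b ^ 2 = 0) :
    curvatureTrace (inducedMetric φ) φ X u = ((n₁ : ℝ) + n₂) • X u := by
  have hp : ⟪φ u, φ u⟫ = 1 := by
    have := inner_blockScale_self 1 1 (h.mem hu)
    rwa [blockScale_one, one_mul, one_mul, hab] at this
  have hpX : ⟪φ u, X u⟫ = 0 := by
    rw [hX, inner_blockScale_right, inner_blockScale_self _ _ (h.mem hu), hαβ]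
  have hpt : ∀ i, ⟪φ u, partialDeriv φ i u⟫ = 0 := by
    intro i
    have := inner_blockScale_partialDeriv h hu 1 1 i
    rwa [blockScale_one] at this
  have htr := sum_gramMatrix_inv_inner_blockScale ha hb (h.mem hu)
    (linearIndependent_partialDeriv (h.injective_fderiv u hu))
    (inner_blockScale_partialDeriv h hu) 1 1
  simp only [blockScale_one, one_mul] at htr
  rw [curvatureTrace, ← htr, Finset.sum_smul]
  refine Finset.sum_congr rfl fun i _ => ?_
  rw [Finset.sum_smul]
  refine Finset.sum_congr rfl fun j _ => ?_
  rw [sphereCurvature_eq hp hpX (hpt i) (hpt j), hX, inner_blockScale_partialDeriv h hu, zero_smul,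
    sub_zero, smul_smul]
  rfl

/-- The bitension field of index `k` of the torus. -/
theorem biharmonic_torus (ha : 0 < a) (hb : 0 < b) (hab : a ^ 2 + b ^ 2 = 1) (k : ℝ)
    (h : IsLocalParametrization (torus n₁ n₂ a b) U φ) (hu : u ∈ U) :
    roughLaplacian (inducedMetric φ) φ (divDifferential (inducedMetric φ) φ) u
      - curvatureTrace (inducedMetric φ) φ (divDifferential (inducedMetric φ) φ) u
      + k • divDifferential (inducedMetric φ) φ u
    = (n₁ * b ^ 2 / a ^ 2 + n₂ * a ^ 2 / b ^ 2 - (n₁ + n₂) + k) •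
        divDifferential (inducedMetric φ) φ u := by
  have hδ : ∀ w ∈ U, divDifferential (inducedMetric φ) φ w
      = blockScale (n₁ / a ^ 2 - (n₁ + n₂)) (n₂ / b ^ 2 - (n₁ + n₂)) (φ w) :=
    fun w hw => divDifferential_torus ha hb h hw
  -- This is the tangency of `δTφ` to the sphere.
  have h0 : ((n₁ : ℝ) / a ^ 2 - (n₁ + n₂)) * a ^ 2 + (n₂ / b ^ 2 - (n₁ + n₂)) * b ^ 2 = 0 := by
    field_simp
    linear_combination -(n₁ + n₂ : ℝ) * hab
  rw [roughLaplacian_blockScale ha hb h hu hδ, curvatureTrace_blockScale ha hb hab h hu (hδ u hu) h0,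
    hδ u hu, smul_blockScale, smul_blockScale, smul_blockScale, blockScale_sub, blockScale_add]
  have ha' : a ^ 2 ≠ 0 := by positivity
  have hb' : b ^ 2 ≠ 0 := by positivity
  generalize a ^ 2 = A at *
  generalize b ^ 2 = B at *
  obtain rfl : B = 1 - A := by linarith
  congr 1
  congr 1 <;> field_simp <;> ring

/-- The bitension is a scalar times `δTφ`, and the vanishing of `δTφ` depends only on `n₁`, `n₂` and
`a`, neither on the chart nor on the point. One point of one chart therefore decides both
properties. -/
theorem isProperlyBiharmonic_torus_iff (ha : 0 < a) (hb : 0 < b) (hab : a ^ 2 + b ^ 2 = 1) (k : ℝ) :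
    IsProperlyBiharmonic (n₁ + n₂) k (torus n₁ n₂ a b) ↔
      (n₁ : ℝ) ≠ (n₁ + n₂) * a ^ 2 ∧
        n₁ * b ^ 2 / a ^ 2 + n₂ * a ^ 2 / b ^ 2 = n₁ + n₂ - k := by
  have hS := isSphereSubmanifold_torus (n₁ := n₁) (n₂ := n₂) ha hb hab
  have hz : ∀ (U : Set (Coord (n₁ + n₂))) (φ : Coord (n₁ + n₂) → Ambient n₁ n₂) (u), u ∈ U →
      IsLocalParametrization (torus n₁ n₂ a b) U φ →
      (divDifferential (inducedMetric φ) φ u = 0 ↔ (n₁ : ℝ) = (n₁ + n₂) * a ^ 2) := by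
    intro U φ u hu h
    rw [divDifferential_torus ha hb h hu, blockScale_eq_zero_iff ha hb (h.mem hu), sub_eq_zero,
      sub_eq_zero, div_eq_iff (by positivity), div_eq_iff (by positivity), and_iff_left_of_imp]
    intro h1
    linear_combination -h1 - (n₁ + n₂ : ℝ) * hab
  obtain ⟨p, hp⟩ := torus_nonempty n₁ n₂ ha.le hb.le
  obtain ⟨U, φ, h, u, hu, -⟩ := hS.2 p hp
  constructor
  · rintro ⟨⟨-, hbi⟩, hnh⟩
    have h1 : (n₁ : ℝ) ≠ (n₁ + n₂) * a ^ 2 := fun h1 =>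
      hnh ⟨hS, fun U φ h u hu => (hz U φ u hu h).2 h1⟩
    refine ⟨h1, ?_⟩
    have h2 := hbi U φ h u hu
    rw [biharmonic_torus ha hb hab k h hu, smul_eq_zero, hz U φ u hu h] at h2
    linarith [h2.resolve_right h1]
  · rintro ⟨h1, h2⟩
    refine ⟨⟨hS, fun U φ h u hu => ?_⟩, fun hh => h1 ((hz U φ u hu h).1 (hh.2 U φ h u hu))⟩
    rw [biharmonic_torus ha hb hab k h hu, h2]
    simp

end Torus

/-! ### Counting the positive roots of the quadratic equation. -/

section Classification

variable {n₁ n₂ : ℕ}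

/-- The generalized Clifford torus `T(a, b)` with `a² / b² = t`. -/
noncomputable def torusOfRatio (n₁ n₂ : ℕ) (t : ℝ) : Set (Ambient n₁ n₂) :=
  torus n₁ n₂ (√(t / (1 + t))) (√(1 / (1 + t)))

theorem torusOfRatio_injOn : InjOn (torusOfRatio n₁ n₂) (Ioi 0) := by
  intro t ht t' ht' h
  rw [mem_Ioi] at ht ht'
  obtain ⟨p, hp⟩ := torus_nonempty n₁ n₂ (Real.sqrt_nonneg (t / (1 + t)))
    (Real.sqrt_nonneg (1 / (1 + t)))
  have hp' : p ∈ torusOfRatio n₁ n₂ t' := h ▸ hp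
  have h1 : √(t / (1 + t)) = √(t' / (1 + t')) := hp.1.symm.trans hp'.1
  rw [Real.sqrt_inj (by positivity) (by positivity), div_eq_div_iff (by positivity) (by positivity)]
    at h1
  linarith

theorem sq_add_sq_torusOfRatio {t : ℝ} (ht : 0 < t) :
    √(t / (1 + t)) ^ 2 + √(1 / (1 + t)) ^ 2 = 1 := by
  rw [Real.sq_sqrt (by positivity), Real.sq_sqrt (by positivity)]
  field_simp
  ring

theorem isProperlyBiharmonic_torusOfRatio_iff (hn₂ : 0 < n₂) {t : ℝ} (ht : 0 < t) (k : ℝ) :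
    IsProperlyBiharmonic (n₁ + n₂) k (torusOfRatio n₁ n₂ t) ↔
      (n₁ : ℝ) ≠ n₂ * t ∧ n₂ * t ^ 2 - (n₁ + n₂ - k) * t + n₁ = 0 := by
  have hn : (0 : ℝ) < n₂ := Nat.cast_pos.2 hn₂
  rw [torusOfRatio, isProperlyBiharmonic_torus_iff (by positivity) (by positivity)
    (sq_add_sq_torusOfRatio ht), Real.sq_sqrt (by positivity), Real.sq_sqrt (by positivity)]
  refine and_congr (not_congr ?_) ?_
  · field_simp
    constructor <;> intro h <;> linarith
  · field_simp
    constructor <;> intro h <;> linarith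

theorem isCliffordTorus_iff (T : Set (Ambient n₁ n₂)) :
    IsCliffordTorus n₁ n₂ T ↔ ∃ t, 0 < t ∧ T = torusOfRatio n₁ n₂ t := by
  constructor
  · rintro ⟨a, ⟨ha0, ha1⟩, rfl⟩
    have h1 : 0 < 1 - a ^ 2 := by nlinarith
    refine ⟨a ^ 2 / (1 - a ^ 2), by positivity, ?_⟩
    have h2 : 1 + a ^ 2 / (1 - a ^ 2) = 1 / (1 - a ^ 2) := by
      field_simp
      ring
    rw [torusOfRatio, h2, one_div_one_div, div_div_div_cancel_right₀ h1.ne', div_one,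
      Real.sqrt_sq ha0.le]
  · rintro ⟨t, ht, rfl⟩
    refine ⟨√(t / (1 + t)), ⟨by positivity, ?_⟩, ?_⟩
    · rw [Real.sqrt_lt' one_pos, one_pow, div_lt_one (by positivity)]
      linarith
    · rw [torusOfRatio, Real.sq_sqrt (by positivity)]
      congr 2
      field_simp
      ring

theorem properTori_eq_image (hn₂ : 0 < n₂) (k : ℝ) :
    properTori n₁ n₂ k = torusOfRatio n₁ n₂ ''
      {t | 0 < t ∧ (n₁ : ℝ) ≠ n₂ * t ∧ n₂ * t ^ 2 - (n₁ + n₂ - k) * t + n₁ = 0} := by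
  ext T
  constructor
  · rintro ⟨h1, h2⟩
    obtain ⟨t, ht, rfl⟩ := (isCliffordTorus_iff T).1 h1
    exact ⟨t, ⟨ht, (isProperlyBiharmonic_torusOfRatio_iff hn₂ ht k).1 h2⟩, rfl⟩
  · rintro ⟨t, ⟨ht, h⟩, rfl⟩
    exact ⟨(isCliffordTorus_iff _).2 ⟨t, ht, rfl⟩,
      (isProperlyBiharmonic_torusOfRatio_iff hn₂ ht k).2 h⟩

/-- For nonzero index the solutions of the quadratic equation are not harmonic. -/
theorem properTori_eq_image_of_ne_zero (hn₂ : 0 < n₂) {k : ℝ} (hk : k ≠ 0) :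
    properTori n₁ n₂ k = torusOfRatio n₁ n₂ ''
      {t | 0 < t ∧ n₂ * t ^ 2 - (n₁ + n₂ - k) * t + n₁ = 0} := by
  rw [properTori_eq_image hn₂]
  congr 1
  ext t
  refine and_congr_right fun ht => and_iff_right_of_imp fun h h1 => hk ?_
  -- Substituting the harmonic ratio `n₁ = n₂ t` leaves only `k t` of the quadratic.
  have h2 : t * k = 0 := by
    rw [h1] at h
    linear_combination h
  exact (mul_eq_zero.1 h2).resolve_left ht.ne'

theorem torusOfRatio_inv {t : ℝ} (ht : 0 < t) :
    torusOfRatio n₁ n₂ t⁻¹ = torus n₁ n₂ (√(1 / (1 + t))) (√(t / (1 + t))) := by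
  rw [torusOfRatio]
  congr 2
  · field_simp
    ring
  · field_simp
    ring

/-- For `t > 0` the quadratic strictly exceeds `(√n₂ t - √n₁)²`. Positivity of `t` also disposes of
large `k`, where real roots exist but are negative. -/
theorem properTori_eq_empty (hn₂ : 0 < n₂) {k : ℝ}
    (hk : (n₁ : ℝ) + n₂ - 2 * √((n₁ : ℝ) * n₂) < k) : properTori n₁ n₂ k = ∅ := by
  rw [properTori_eq_image hn₂, image_eq_empty, eq_empty_iff_forall_notMem]
  rintro t ⟨ht, -, h⟩
  rw [Real.sqrt_mul (Nat.cast_nonneg _)] at hk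
  have h1 : √(n₁ : ℝ) ^ 2 = n₁ := Real.sq_sqrt (Nat.cast_nonneg _)
  have h2 : √(n₂ : ℝ) ^ 2 = n₂ := Real.sq_sqrt (Nat.cast_nonneg _)
  have h3 := mul_lt_mul_of_pos_right hk ht
  have h4 := sq_nonneg (√(n₂ : ℝ) * t - √(n₁ : ℝ))
  have h5 : (√(n₂ : ℝ) * t - √(n₁ : ℝ)) ^ 2 = n₂ * t ^ 2 - 2 * (√(n₁ : ℝ) * √(n₂ : ℝ)) * t + n₁ := by
    linear_combination t ^ 2 * h2 + h1
  linarith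

/-- At the critical index the quadratic is the square `(√n₂ t - √n₁)²`, with one double root. -/
theorem existsUnique_mem_properTori (hn₁ : 0 < n₁) (hn₂ : 0 < n₂) {k : ℝ}
    (hk : k = (n₁ : ℝ) + n₂ - 2 * √((n₁ : ℝ) * n₂)) (hk0 : k ≠ 0) :
    ∃! T, T ∈ properTori n₁ n₂ k := by
  rw [properTori_eq_image_of_ne_zero hn₂ hk0]
  rw [Real.sqrt_mul (Nat.cast_nonneg _)] at hk
  have h1 : √(n₁ : ℝ) ^ 2 = n₁ := Real.sq_sqrt (Nat.cast_nonneg _)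
  have h2 : √(n₂ : ℝ) ^ 2 = n₂ := Real.sq_sqrt (Nat.cast_nonneg _)
  have hp1 : 0 < √(n₁ : ℝ) := Real.sqrt_pos.2 (Nat.cast_pos.2 hn₁)
  have hp2 : 0 < √(n₂ : ℝ) := Real.sqrt_pos.2 (Nat.cast_pos.2 hn₂)
  have h3 : {t : ℝ | 0 < t ∧ n₂ * t ^ 2 - (n₁ + n₂ - k) * t + n₁ = 0}
      = {√(n₁ : ℝ) / √(n₂ : ℝ)} := by
    ext t
    have h4 : n₂ * t ^ 2 - (n₁ + n₂ - k) * t + n₁ = (√(n₂ : ℝ) * t - √(n₁ : ℝ)) ^ 2 := by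
      rw [hk]
      linear_combination -t ^ 2 * h2 - h1
    rw [mem_ofPred_eq, h4, mem_singleton_iff, eq_div_iff hp2.ne', pow_eq_zero_iff two_ne_zero,
      sub_eq_zero, mul_comm t, and_iff_right_of_imp]
    intro h5
    exact pos_of_mul_pos_right (h5 ▸ hp1) hp2.le
  rw [h3, image_singleton]
  exact ⟨_, rfl, fun _ h => h⟩

theorem exists_properTori_eq_pair (hn₁ : 0 < n₁) (hn₂ : 0 < n₂) {k : ℝ}
    (hk : k < (n₁ : ℝ) + n₂ - 2 * √((n₁ : ℝ) * n₂)) (hk0 : k ≠ 0) :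
    ∃ t t' : ℝ, 0 < t ∧ 0 < t' ∧ t ≠ t' ∧ n₂ * (t * t') = n₁ ∧
      properTori n₁ n₂ k = {torusOfRatio n₁ n₂ t, torusOfRatio n₁ n₂ t'} := by
  have hm : (0 : ℝ) < n₁ := Nat.cast_pos.2 hn₁
  have hn : (0 : ℝ) < n₂ := Nat.cast_pos.2 hn₂
  obtain ⟨q, hq⟩ : ∃ q : ℝ, q = n₁ + n₂ - k := ⟨_, rfl⟩
  have hr : 0 < √((n₁ : ℝ) * n₂) := by positivity
  have hr2 : √((n₁ : ℝ) * n₂) ^ 2 = n₁ * n₂ := Real.sq_sqrt (by positivity)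
  have hq0 : 0 < q := by linarith
  have hD : 0 < q ^ 2 - 4 * (n₁ * n₂) := by
    rw [← hr2]
    nlinarith
  set d := √(q ^ 2 - 4 * (n₁ * n₂)) with hd
  have hd0 : 0 < d := Real.sqrt_pos.2 hD
  have hd2 : d ^ 2 = q ^ 2 - 4 * (n₁ * n₂) := Real.sq_sqrt hD.le
  -- This makes the smaller root positive.
  have hdq : d < q := by
    refine lt_of_pow_lt_pow_left₀ 2 hq0.le ?_
    rw [hd2]
    linarith [mul_pos hm hn]
  -- The factor `4 n₂` completes the square.
  have hfac : ∀ t : ℝ, 4 * n₂ * (n₂ * t ^ 2 - q * t + n₁)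
      = (2 * n₂ * t - (q - d)) * (2 * n₂ * t - (q + d)) := by
    intro t
    linear_combination hd2
  refine ⟨(q - d) / (2 * n₂), (q + d) / (2 * n₂), div_pos (by linarith) (by linarith),
    by positivity, ?_, ?_, ?_⟩
  · rw [ne_eq, div_left_inj' (by positivity)]
    linarith
  · field_simp
    linear_combination -hd2
  · rw [properTori_eq_image_of_ne_zero hn₂ hk0, ← image_pair, ← hq]
    congr 1
    ext t
    have h4 : n₂ * t ^ 2 - q * t + n₁ = 0 ↔ t = (q - d) / (2 * n₂) ∨ t = (q + d) / (2 * n₂) := by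
      rw [← mul_right_inj' (show (4 * n₂ : ℝ) ≠ 0 by positivity), mul_zero, hfac, mul_eq_zero,
        sub_eq_zero, sub_eq_zero, eq_div_iff (by positivity), eq_div_iff (by positivity),
        mul_comm t]
    rw [mem_ofPred_eq, h4, mem_insert_iff, mem_singleton_iff, and_iff_right_of_imp]
    rintro (rfl | rfl)
    · exact div_pos (by linarith) (by linarith)
    · positivity

end Classification

end BiharmonicIndex

theorem mainTheorem5 (n₁ n₂ : ℕ) (hn₁ : 0 < n₁) (hn₂ : 0 < n₂) (k : ℝ) :
    ((n₁ : ℝ) + n₂ - 2 * √((n₁ : ℝ) * n₂) < k → BiharmonicIndex.properTori n₁ n₂ k = ∅) ∧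
    (k = (n₁ : ℝ) + n₂ - 2 * √((n₁ : ℝ) * n₂) → k ≠ 0 →
      ∃! T, T ∈ BiharmonicIndex.properTori n₁ n₂ k) ∧
    (k < (n₁ : ℝ) + n₂ - 2 * √((n₁ : ℝ) * n₂) → k ≠ 0 →
      (BiharmonicIndex.properTori n₁ n₂ k).ncard = 2 ∧
      (n₁ = n₂ → ∃ a b : ℝ, 0 < a ∧ 0 < b ∧ a ^ 2 + b ^ 2 = 1 ∧ a ≠ b ∧
        BiharmonicIndex.properTori n₁ n₂ k =
          {BiharmonicIndex.torus n₁ n₂ a b, BiharmonicIndex.torus n₁ n₂ b a})) := by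
  refine ⟨BiharmonicIndex.properTori_eq_empty hn₂,
    BiharmonicIndex.existsUnique_mem_properTori hn₁ hn₂, fun hk hk0 => ?_⟩
  obtain ⟨t, t', ht, ht', hne, hprod, h⟩ :=
    BiharmonicIndex.exists_properTori_eq_pair hn₁ hn₂ hk hk0
  refine ⟨?_, ?_⟩
  · rw [h, Set.ncard_pair (BiharmonicIndex.torusOfRatio_injOn.ne ht ht' hne)]
  · rintro rfl
    have hn : (n₁ : ℝ) ≠ 0 := (Nat.cast_pos.2 hn₁).ne'
    have htt : t * t' = 1 := mul_left_cancel₀ hn (hprod.trans (mul_one _).symm)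
    obtain rfl : t' = t⁻¹ := eq_inv_of_mul_eq_one_right htt
    refine ⟨√(t / (1 + t)), √(1 / (1 + t)), by positivity, by positivity,
      BiharmonicIndex.sq_add_sq_torusOfRatio ht, fun hab => hne ?_, ?_⟩
    -- Equal radii would give `t = 1`, hence `t = t⁻¹`.
    · rw [Real.sqrt_inj (by positivity) (by positivity), div_left_inj' (by positivity)] at hab
      rw [hab, inv_one]
    · rw [h, BiharmonicIndex.torusOfRatio_inv ht]
      rfl
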